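/- Let $\Omega$ be a set and let $\mathscr H$ be a linear space of real functions on $\Omega$ such that $\varphi(X_1,\dots,X_n)\in\mathscr H$ whenever $X_1,\dots,X_n\in\mathscr H$ and $\varphi\in C_{l,Lip}(\mathbb R^n)$, where $C_{l,Lip}(\mathbb R^n)$ is the set of $\varphi:\mathbb R^n\to\mathbb R$ for which there are $C>0$ and $m\in\mathbb N$ with $|\varphi(x)-\varphi(y)|\le C(1+|x|^m+|y|^m)|x-y|$ for all $x,y$. Let $\widehat{\mathbb E}:\mathscr H\to[-\infty,\infty]$ be a sub-linear expectation, that is: $\widehat{\mathbb E}[X]\ge\widehat{\mathbb E}[Y]$ if $X\ge Y$; $\widehat{\mathbb E}[c]=c$ for constants $c\in\mathbb R$; $\widehat{\mathbb E}[X+Y]\le\widehat{\mathbb E}[X]+\widehat{\mathbb E}[Y]$ whenever the right-hand side is not of the form $\infty-\infty$ or $-\infty+\infty$; and $\widehat{\mathbb E}[\lambda X]=\lambda\widehat{\mathbb E}[X]$ for real $\lambda\ge0$ (with $0\cdot(\pm\infty)=0$). For $A\subset\Omega$ define the upper and lower capacities by $$\mathbb V(A)=\inf\{\widehat{\mathbb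 E}[\xi]: I_A\le\xi,\ \xi\in\mathscr H\},\qquad \mathcal V(A)=1-\mathbb V(A^c).$$ Let $\mathscr H_1=\{X\in\mathscr H:\lim_{c,d\to\infty}\widehat{\mathbb E}[(|X|\wedge d-c)^+]=0\}$ and, for $X\in\mathscr H_1$, let $\breve{\mathbb E}[X]=\lim_{c\to\infty}\widehat{\mathbb E}[(-c)\vee X\wedge c]$ (this limit exists). Let $\mathscr E$ be the set of finitely additive linear expectations $E:\mathscr H_1\to\mathbb R$ (linear, monotone, with $E[c]=c$) such that $E\le\breve{\mathbb E}$ on $\mathscr H_1$. A random vector is a map $\Omega\to\mathbb R^d$ whose coordinates belong to $\mathscr H$; for such $Z=(Z_1,\dots,Z_d)$ with coordinates in $\mathscr H_1$ and $E\in\mathscr E$ write $E[Z]=(E[Z_1],\dots,E[Z_d])$. A random vector $Y$ is independent to a random vector $X$ if $$\widehat{\mathbb E}[\varphi(X,Y)]=\widehat{\mathbb E}\big[\widehat{\mathbb E}[\varphi(x,Y)]\big|_{x=X}\big]$$ for every $\varphi\in C_{l,Lip}$ such that $\overline\varphi(x):=\widehat{\mathbb E}[|\varphi(x,Y)|]<\infty$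 for all $x$, the functions $\overline\varphi(X)$ and $\widehat{\mathbb E}[\varphi(x,Y)]|_{x=X}$ belong to $\mathscr H$, and $\widehat{\mathbb E}[|\overline\varphi(X)|]<\infty$. A sequence $Z_1,\dots,Z_N$ of random vectors is independent if $Z_{j+1}$ is independent to $(Z_1,\dots,Z_j)$ for each $1\le j<N$. Let $\{Z_{n,k};\ k=1,\dots,k_n\}$ be an array of random vectors in $\mathbb R^d$ such that, for each $n$, the sequence $Z_{n,1},\dots,Z_{n,k_n}$ is independent and $\widehat{\mathbb E}[|Z_{n,k}|^2]<\infty$ for all $k$, where $|\cdot|$ is the Euclidean norm. For all $n$ and $k$ let $\mu_{n,k}\in\{E[Z_{n,k}]:E\in\mathscr E\}$. Then, for all $n$ and all $x>0$, $$\mathcal V\Big(\max_{m\le k_n}\Big|\sum_{k=1}^m(Z_{n,k}-\mu_{n,k})\Big|\ge x\Big)\le 2x^{-2}\sum_{k=1}^{k_n}\Big(\widehat{\mathbb E}[|Z_{n,k}|^2]-|\mu_{n,k}|^2\Big).$$ -/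

import Mathlib

open Filter Topology

namespace SubLinear

/-- The class `C_{l,Lip}` of functions `φ` with
`|φ x - φ y| ≤ C (1 + |x|^m + |y|^m) |x - y|` for some `C > 0` and `m ∈ ℕ`.
On a finite dimensional space the class does not depend on the choice of the norm, since a change
to an equivalent norm only changes `C`. -/
def CLLip {E : Type*} [NormedAddCommGroup E] (φ : E → ℝ) : Prop :=
  ∃ C : ℝ, 0 < C ∧ ∃ m : ℕ, ∀ x y : E, |φ x - φ y| ≤ C * (1 + ‖x‖ ^ m + ‖y‖ ^ m) * ‖x - y‖

/-- A sub-linear expectation space `(Ω, H, 𝔼)`. The expectation takes values in `[-∞, ∞]`.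
It is a function on `H`; `exp` is written as a function on all of `Ω → ℝ`, but its values outside
`H` are irrelevant: no axiom and no definition below refers to them. -/
structure Space (Ω : Type*) where
  /-- the linear space of random variables -/
  H : Submodule ℝ (Ω → ℝ)
  /-- `φ(X₁, …, Xₙ) ∈ H` for `X₁, …, Xₙ ∈ H` and `φ ∈ C_{l,Lip}(ℝⁿ)` -/
  comp_mem : ∀ (n : ℕ) (X : Fin n → Ω → ℝ), (∀ i, X i ∈ H) →
    ∀ φ : EuclideanSpace ℝ (Fin n) → ℝ, CLLip φ →
      (fun ω => φ (WithLp.toLp 2 fun i => X i ω)) ∈ H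
  /-- the sub-linear expectation -/
  exp : (Ω → ℝ) → EReal
  mono : ∀ X ∈ H, ∀ Y ∈ H, Y ≤ X → exp Y ≤ exp X
  const : ∀ c : ℝ, exp (fun _ => c) = (c : EReal)
  subadd : ∀ X ∈ H, ∀ Y ∈ H, ¬(exp X = ⊤ ∧ exp Y = ⊥) → ¬(exp X = ⊥ ∧ exp Y = ⊤) →
    exp (X + Y) ≤ exp X + exp Y
  homog : ∀ X ∈ H, ∀ a : ℝ, 0 ≤ a → exp (a • X) = (a : EReal) * exp X

namespace Space

variable {Ω : Type*} (S : Space Ω)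

/-- Upper capacity `𝕍(A) = inf {𝔼[ξ] : I_A ≤ ξ, ξ ∈ H}`. -/
noncomputable def upperCap (A : Set Ω) : EReal :=
  ⨅ ξ ∈ {ξ : Ω → ℝ | ξ ∈ S.H ∧ A.indicator (fun _ => (1 : ℝ)) ≤ ξ}, S.exp ξ

/-- Lower capacity `𝒱(A) = 1 - 𝕍(Aᶜ)`. -/
noncomputable def lowerCap (A : Set Ω) : EReal :=
  1 - S.upperCap Aᶜ

/-- `X` is a random vector: all its coordinates belong to `H`. -/
def IsRandomVector {d : ℕ} (X : Ω → EuclideanSpace ℝ (Fin d)) : Prop :=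
  ∀ i, (fun ω => X ω i) ∈ S.H

/-- The random vector `Y` is independent to the random vector `X`: for `φ ∈ C_{l,Lip}`,
`𝔼[φ(X, Y)] = 𝔼[𝔼[φ(x, Y)]|_{x = X}]` whenever `φ'(x) := 𝔼[|φ(x, Y)|] < ∞` for all `x` and
`𝔼[|φ'(X)|] < ∞`. The identity is required only if the functions of `X` whose expectation is taken,
`φ'(X)` and `𝔼[φ(x, Y)]|_{x = X}`, belong to the domain `H` of the expectation. The inner
expectations are finite by the first condition, hence the `toReal`. -/
def IndepTo {E F : Type*} [NormedAddCommGroup E] [NormedAddCommGroup F]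
    (Y : Ω → F) (X : Ω → E) : Prop :=
  ∀ φ : E × F → ℝ, CLLip φ →
    (∀ x : E, S.exp (fun ω => |φ (x, Y ω)|) < ⊤) →
    (fun ω' => (S.exp (fun ω => |φ (X ω', Y ω)|)).toReal) ∈ S.H →
    S.exp (fun ω' => |(S.exp (fun ω => |φ (X ω', Y ω)|)).toReal|) < ⊤ →
    (fun ω' => (S.exp (fun ω => φ (X ω', Y ω))).toReal) ∈ S.H →
    S.exp (fun ω => φ (X ω, Y ω)) =
      S.exp (fun ω' => (S.exp (fun ω => φ (X ω', Y ω))).toReal)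

/-- `Z₁, …, Z_N` is an independent sequence of random vectors: each `Z_j` is independent to
`(Z_i)_{i < j}`. (For the first `j` the condition is automatic.) -/
def IndepSeq {d N : ℕ} (Z : Fin N → Ω → EuclideanSpace ℝ (Fin d)) : Prop :=
  ∀ j : Fin N, S.IndepTo (Z j)
    (fun ω (i : Fin (j : ℕ)) => Z ⟨i, i.isLt.trans j.isLt⟩ ω)

/-- The subspace `H₁ = {X ∈ H : lim_{c,d → ∞} 𝔼[(|X| ∧ d - c)⁺] = 0}`. -/
def H1 : Set (Ω → ℝ) :=
  {X | X ∈ S.H ∧ Tendsto (fun p : ℝ × ℝ => S.exp (fun ω => max (min |X ω| p.2 - p.1) 0))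
    (atTop ×ˢ atTop) (𝓝 0)}

/-- `𝔼̆[X] = lim_{c → ∞} 𝔼[(-c) ∨ X ∧ c]`; the limit exists for `X ∈ H₁`. -/
noncomputable def truncExp (X : Ω → ℝ) : EReal :=
  limUnder atTop fun c : ℝ => S.exp (fun ω => max (-c) (min (X ω) c))

/-- `L` is a finitely additive linear expectation on `H₁` (real valued) with `L ≤ 𝔼̆` on `H₁`.
Only the values of `L` on `H₁` are relevant. -/
structure IsDominated (L : (Ω → ℝ) → ℝ) : Prop where
  mono : ∀ X ∈ S.H1, ∀ Y ∈ S.H1, Y ≤ X → L Y ≤ L X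
  const : ∀ c : ℝ, L (fun _ => c) = c
  add : ∀ X ∈ S.H1, ∀ Y ∈ S.H1, L (X + Y) = L X + L Y
  smul : ∀ X ∈ S.H1, ∀ a : ℝ, L (a • X) = a * L X
  le : ∀ X ∈ S.H1, (L X : EReal) ≤ S.truncExp X

/-- The set of means `{L[X] : L}`, where `L` runs over the dominated finitely additive linear
expectations and `L[X] = (L[X₁], …, L[X_d])`. -/
def meanSet {d : ℕ} (X : Ω → EuclideanSpace ℝ (Fin d)) : Set (EuclideanSpace ℝ (Fin d)) :=
  {μ | ∃ L : (Ω → ℝ) → ℝ, S.IsDominated L ∧ μ = WithLp.toLp 2 fun i => L (fun ω => X ω i)}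

end Space

end SubLinear

/-! Write `S_k` for the centred partial sums and let `g_k` be the product of Lipschitz cutoffs of
`|S_1|, …, |S_k|`, a smooth substitute for the indicator of `max_{m ≤ k} |S_m| < x`. Indicators need
not lie in `H`, so the stopping argument of Kolmogorov's inequality is run with the weights `g_k`.
Put `W_k = ∑_{i<k} g_i (|S_{i+1}|² - |S_i|²)`. Pathwise, `x²/2 · (1 - g_k) ≤ W_k`
(`le_weightedSquares`), so `1 - 2 W_N / x² ≤ g_N`, and `g_N` is at most the indicator of `max |S_m|
< x`. Every `ξ` competing in the upper capacity of that event therefore has expectation at least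
`𝔼[1 - 2 W_N / x²]`.

It remains to show `𝔼[-W_N] ≥ -∑ (𝔼|Z_k|² - |μ_k|²)` (`le_rexp_neg_weightedSquares`). Given the
past, an increment of `-W` is a quadratic polynomial in `Z_k - μ_k` with leading coefficient `-g_k`.
Its linear part is controlled by `⟨v, μ_k⟩ ≤ 𝔼⟨v, Z_k⟩`, valid for all `v` because `μ_k` is a mean
under a dominated linear expectation, and its quadratic part by sub-additivity
(`le_rexp_quadratic`). Independence transfers this bound to the random past (`le_rexp_of_indepTo`).
Only lower bounds on an upper expectation occur, which is why a single mean suffices and the result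
concerns the lower capacity. -/

namespace SubLinear

/-! ### Calculus of polynomially Lipschitz maps -/

section PolyLip

variable {E F G : Type*} [NormedAddCommGroup E] [NormedAddCommGroup F] [NormedAddCommGroup G]

/-- Local Lipschitz continuity with a Lipschitz constant of polynomial growth, for maps between
normed groups. For real functions this is `CLLip`. -/
def PolyLip (f : E → F) : Prop :=
  ∃ C : ℝ, 0 ≤ C ∧ ∃ m : ℕ, ∀ x y : E, ‖f x - f y‖ ≤ C * (1 + ‖x‖ + ‖y‖) ^ m * ‖x - y‖

/-- A power of `1 + ‖x‖ + ‖y‖` is monotone in the exponent and multiplicative, which makes closure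
under composition and bilinear operations direct. -/
theorem cllip_iff_polyLip {φ : E → ℝ} : CLLip φ ↔ PolyLip φ := by
  constructor
  · rintro ⟨C, hC, m, h⟩
    refine ⟨3 * C, by positivity, m, fun x y => (h x y).trans ?_⟩
    have hx := norm_nonneg x
    have hy := norm_nonneg y
    have h1 : (1 : ℝ) ≤ (1 + ‖x‖ + ‖y‖) ^ m := one_le_pow₀ (by linarith)
    have h2 : ‖x‖ ^ m ≤ (1 + ‖x‖ + ‖y‖) ^ m := pow_le_pow_left₀ hx (by linarith) m
    have h3 : ‖y‖ ^ m ≤ (1 + ‖x‖ + ‖y‖) ^ m := pow_le_pow_left₀ hy (by linarith) m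
    have h4 : C * (1 + ‖x‖ ^ m + ‖y‖ ^ m) ≤ C * (3 * (1 + ‖x‖ + ‖y‖) ^ m) :=
      mul_le_mul_of_nonneg_left (by linarith) hC.le
    exact mul_le_mul_of_nonneg_right (by linarith) (norm_nonneg _)
  · rintro ⟨C, hC, m, h⟩
    refine ⟨C * 3 ^ m + 1, by positivity, m, fun x y => (h x y).trans ?_⟩
    have hx := norm_nonneg x
    have hy := norm_nonneg y
    have key : (1 + ‖x‖ + ‖y‖) ^ m ≤ 3 ^ m * (1 + ‖x‖ ^ m + ‖y‖ ^ m) := by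
      have hx' : 0 ≤ ‖x‖ ^ m := by positivity
      have hy' : 0 ≤ ‖y‖ ^ m := by positivity
      -- Applied with `t` the largest of `1`, `‖x‖`, `‖y‖`, whose power is one of the three summands
      -- on the right.
      have aux : ∀ t : ℝ, 0 ≤ t → 1 ≤ t → ‖x‖ ≤ t → ‖y‖ ≤ t →
          (1 + ‖x‖ + ‖y‖) ^ m ≤ 3 ^ m * t ^ m := fun t ht h1 h2 h3 => by
        rw [← mul_pow]
        exact pow_le_pow_left₀ (by positivity) (by linarith) m
      rcases le_total ‖x‖ ‖y‖ with hxy | hxy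
      · rcases le_total 1 ‖y‖ with h1 | h1
        · exact (aux _ hy h1 hxy le_rfl).trans (by gcongr; linarith)
        · refine (aux 1 zero_le_one le_rfl (hxy.trans h1) h1).trans ?_
          rw [one_pow]; gcongr; linarith
      · rcases le_total 1 ‖x‖ with h1 | h1
        · exact (aux _ hx h1 le_rfl hxy).trans (by gcongr; linarith)
        · refine (aux 1 zero_le_one le_rfl h1 (hxy.trans h1)).trans ?_
          rw [one_pow]; gcongr; linarith
    refine mul_le_mul_of_nonneg_right ?_ (norm_nonneg _)
    calc C * (1 + ‖x‖ + ‖y‖) ^ m ≤ C * (3 ^ m * (1 + ‖x‖ ^ m + ‖y‖ ^ m)) := by gcongr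
      _ = C * 3 ^ m * (1 + ‖x‖ ^ m + ‖y‖ ^ m) := by ring
      _ ≤ (C * 3 ^ m + 1) * (1 + ‖x‖ ^ m + ‖y‖ ^ m) := by gcongr; linarith

namespace PolyLip

theorem of_lipschitz {f : E → F} (K : ℝ) (hK : 0 ≤ K) (h : ∀ x y, ‖f x - f y‖ ≤ K * ‖x - y‖) :
    PolyLip f :=
  ⟨K, hK, 0, fun x y => by simpa using h x y⟩

theorem const (c : F) : PolyLip (fun _ : E => c) :=
  of_lipschitz 0 le_rfl (by simp)

theorem id : PolyLip (fun x : E => x) :=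
  of_lipschitz 1 zero_le_one (by simp)

theorem fst : PolyLip (fun p : E × F => p.1) :=
  of_lipschitz 1 zero_le_one fun x y => by simpa using norm_fst_le (x - y)

theorem snd : PolyLip (fun p : E × F => p.2) :=
  of_lipschitz 1 zero_le_one fun x y => by simpa using norm_snd_le (x - y)

theorem norm : PolyLip (fun x : E => ‖x‖) :=
  of_lipschitz 1 zero_le_one fun x y => by simpa using abs_norm_sub_norm_le x y

theorem clm [NormedSpace ℝ E] [NormedSpace ℝ F] (T : E →L[ℝ] F) : PolyLip (fun x => T x) :=
  of_lipschitz ‖T‖ (norm_nonneg _) fun x y => by simpa using T.le_opNorm (x - y)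

/-- A common exponent for two maps. -/
theorem exists_common {f : E → F} {g : E → G} (hf : PolyLip f) (hg : PolyLip g) :
    ∃ C : ℝ, 0 ≤ C ∧ ∃ m : ℕ, (∀ x y, ‖f x - f y‖ ≤ C * (1 + ‖x‖ + ‖y‖) ^ m * ‖x - y‖) ∧
      ∀ x y, ‖g x - g y‖ ≤ C * (1 + ‖x‖ + ‖y‖) ^ m * ‖x - y‖ := by
  obtain ⟨C, hC, m, h⟩ := hf
  obtain ⟨D, hD, k, h'⟩ := hg
  refine ⟨max C D, hC.trans (le_max_left _ _), max m k, fun x y => (h x y).trans ?_,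
    fun x y => (h' x y).trans ?_⟩
  all_goals
    have h1 : 1 ≤ 1 + ‖x‖ + ‖y‖ := by linarith [norm_nonneg x, norm_nonneg y]
    gcongr
    all_goals simp

theorem of_norm_sub_le {f : E → F} {g : E → G} (hg : PolyLip g) (K : ℝ) (hK : 0 ≤ K)
    (h : ∀ x y, ‖f x - f y‖ ≤ K * ‖g x - g y‖) : PolyLip f := by
  obtain ⟨C, hC, m, h'⟩ := hg
  refine ⟨K * C, by positivity, m, fun x y => (h x y).trans ?_⟩
  rw [mul_assoc, mul_assoc, ← mul_assoc C]
  exact mul_le_mul_of_nonneg_left (h' x y) hK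

theorem prodMk {f : E → F} {g : E → G} (hf : PolyLip f) (hg : PolyLip g) :
    PolyLip (fun x => (f x, g x)) := by
  obtain ⟨C, hC, m, h, h'⟩ := hf.exists_common hg
  exact ⟨C, hC, m, fun x y => by simpa [Prod.norm_def] using ⟨h x y, h' x y⟩⟩

theorem norm_le {f : E → F} (hf : PolyLip f) :
    ∃ C : ℝ, 1 ≤ C ∧ ∃ m : ℕ, ∀ x, ‖f x‖ ≤ C * (1 + ‖x‖) ^ m := by
  obtain ⟨C, hC, m, h⟩ := hf
  refine ⟨1 + ‖f 0‖ + C, by linarith [norm_nonneg (f 0)], m + 1, fun x => ?_⟩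
  have h0 := h x 0
  simp only [norm_zero, add_zero, sub_zero] at h0
  have hx := norm_nonneg x
  have h1 : (1 : ℝ) ≤ (1 + ‖x‖) ^ (m + 1) := one_le_pow₀ (by linarith)
  have h2 : ‖f x‖ ≤ ‖f 0‖ + ‖f x - f 0‖ := by simpa using norm_add_le (f 0) (f x - f 0)
  have h3 : C * (1 + ‖x‖) ^ m * ‖x‖ ≤ C * (1 + ‖x‖) ^ (m + 1) := by
    rw [pow_succ, ← mul_assoc]; gcongr; linarith
  nlinarith [norm_nonneg (f 0)]

theorem comp {g : F → G} {f : E → F} (hg : PolyLip g) (hf : PolyLip f) :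
    PolyLip (fun x => g (f x)) := by
  obtain ⟨A, hA, k, hA'⟩ := hf.norm_le
  obtain ⟨C, hC, m, h⟩ := hf
  obtain ⟨D, hD, l, h'⟩ := hg
  refine ⟨D * (3 * A) ^ l * C, by positivity, k * l + m, fun x y => (h' _ _).trans ?_⟩
  have hx := norm_nonneg x
  have hy := norm_nonneg y
  set r := 1 + ‖x‖ + ‖y‖ with hr
  have h1 : 1 + ‖f x‖ + ‖f y‖ ≤ 3 * A * r ^ k := by
    have e1 : 1 ≤ r ^ k := one_le_pow₀ (by linarith)
    have e2 : A * (1 + ‖x‖) ^ k ≤ A * r ^ k := by gcongr; linarith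
    have e3 : A * (1 + ‖y‖) ^ k ≤ A * r ^ k := by gcongr; linarith
    have := hA' x
    have := hA' y
    nlinarith
  calc D * (1 + ‖f x‖ + ‖f y‖) ^ l * ‖f x - f y‖
      ≤ D * (3 * A * r ^ k) ^ l * (C * r ^ m * ‖x - y‖) := by
        gcongr
        exact h x y
    _ = D * (3 * A) ^ l * C * r ^ (k * l + m) * ‖x - y‖ := by
        rw [mul_pow _ (r ^ k), pow_add, pow_mul]; ring

theorem add {f g : E → F} (hf : PolyLip f) (hg : PolyLip g) : PolyLip (fun x => f x + g x) :=
  (of_lipschitz 2 zero_le_two fun x y => by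
    have h1 := norm_fst_le (x - y)
    have h2 := norm_snd_le (x - y)
    have h3 := norm_add_le (x - y).1 (x - y).2
    have h4 : x.1 + x.2 - (y.1 + y.2) = (x - y).1 + (x - y).2 := by simp; abel
    rw [h4]; linarith : PolyLip fun p : F × F => p.1 + p.2).comp (hf.prodMk hg)

theorem neg {f : E → F} (hf : PolyLip f) : PolyLip (fun x => - f x) :=
  hf.of_norm_sub_le 1 zero_le_one fun x y => by
    rw [one_mul, neg_sub_neg, norm_sub_rev]

theorem sub {f g : E → F} (hf : PolyLip f) (hg : PolyLip g) : PolyLip (fun x => f x - g x) := by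
  simpa only [sub_eq_add_neg] using hf.add hg.neg

theorem finset_sum {ι : Type*} (s : Finset ι) {f : ι → E → F} (hf : ∀ i ∈ s, PolyLip (f i)) :
    PolyLip (fun x => ∑ i ∈ s, f i x) := by
  classical
  induction s using Finset.induction_on with
  | empty => simpa using const 0
  | insert a s ha ih =>
    simp only [Finset.sum_insert ha]
    exact (hf a (Finset.mem_insert_self _ _)).add
      (ih fun i hi => hf i (Finset.mem_insert_of_mem hi))

theorem bilin [NormedSpace ℝ F] [NormedSpace ℝ G] {H : Type*} [NormedAddCommGroup H]
    [NormedSpace ℝ H] (B : F →L[ℝ] G →L[ℝ] H) {f : E → F} {g : E → G} (hf : PolyLip f)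
    (hg : PolyLip g) : PolyLip (fun x => B (f x) (g x)) := by
  refine (?_ : PolyLip fun p : F × G => B p.1 p.2).comp (hf.prodMk hg)
  refine ⟨‖B‖, B.opNorm_nonneg, 1, fun x y => ?_⟩
  have h : B x.1 x.2 - B y.1 y.2 = B x.1 (x - y).2 + B (x - y).1 y.2 := by simp
  have h1 := B.le_opNorm₂ x.1 (x - y).2
  have h2 := B.le_opNorm₂ (x - y).1 y.2
  have e1 : ‖B‖ * ‖x.1‖ * ‖(x - y).2‖ ≤ ‖B‖ * ‖x‖ * ‖x - y‖ := by
    gcongr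
    exacts [norm_fst_le x, norm_snd_le _]
  have e2 : ‖B‖ * ‖(x - y).1‖ * ‖y.2‖ ≤ ‖B‖ * ‖x - y‖ * ‖y‖ := by
    gcongr
    exacts [norm_fst_le _, norm_snd_le y]
  have e3 : 0 ≤ ‖B‖ * ‖x - y‖ := mul_nonneg B.opNorm_nonneg (norm_nonneg _)
  rw [h, pow_one]
  refine (norm_add_le _ _).trans ?_
  linarith

theorem mul {f g : E → ℝ} (hf : PolyLip f) (hg : PolyLip g) : PolyLip (fun x => f x * g x) :=
  bilin (ContinuousLinearMap.mul ℝ ℝ) hf hg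

theorem smul [NormedSpace ℝ F] {f : E → ℝ} {g : E → F} (hf : PolyLip f) (hg : PolyLip g) :
    PolyLip (fun x => f x • g x) :=
  bilin (ContinuousLinearMap.lsmul ℝ ℝ) hf hg

theorem inner {V : Type*} [NormedAddCommGroup V] [InnerProductSpace ℝ V] {f g : E → V}
    (hf : PolyLip f) (hg : PolyLip g) : PolyLip (fun x => inner ℝ (f x) (g x)) :=
  bilin (innerSL ℝ) hf hg

theorem norm_sq {f : E → F} (hf : PolyLip f) : PolyLip (fun x => ‖f x‖ ^ 2) := by
  simpa only [sq] using (norm.comp hf).mul (norm.comp hf)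

end PolyLip

end PolyLip

namespace Space

variable {Ω : Type*} (S : Space Ω)

/-! ### Functions of random vectors that stay in `H` -/

section Membership

variable {S}

/-- The `n` vectors are flattened into `n * d` scalar variables by a linear reindexing, which
preserves `PolyLip`. -/
theorem comp_polyLip_mem {d n : ℕ} {X : Fin n → Ω → EuclideanSpace ℝ (Fin d)}
    (hX : ∀ i, S.IsRandomVector (X i)) {φ : (Fin n → EuclideanSpace ℝ (Fin d)) → ℝ}
    (hφ : PolyLip φ) : (fun ω => φ fun i => X i ω) ∈ S.H := by
  let T : EuclideanSpace ℝ (Fin (n * d)) →ₗ[ℝ] (Fin n → EuclideanSpace ℝ (Fin d)) :=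
    { toFun := fun x i => WithLp.toLp 2 fun j => x (finProdFinEquiv (i, j))
      map_add' := fun x y => by ext; simp
      map_smul' := fun c x => by ext; simp }
  have h := S.comp_mem (n * d)
    (fun q ω => X (finProdFinEquiv.symm q).1 ω (finProdFinEquiv.symm q).2)
    (fun q => hX _ _) _ (cllip_iff_polyLip.2 (hφ.comp (PolyLip.clm T.toContinuousLinearMap)))
  convert h using 3 with ω
  ext i j
  have hq := finProdFinEquiv.symm_apply_apply (i, j)
  change X i ω j = X (finProdFinEquiv.symm (finProdFinEquiv (i, j))).1 ω
    (finProdFinEquiv.symm (finProdFinEquiv (i, j))).2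
  rw [hq]

theorem IsRandomVector.comp_mem {d : ℕ} {Y : Ω → EuclideanSpace ℝ (Fin d)}
    (hY : S.IsRandomVector Y) {φ : EuclideanSpace ℝ (Fin d) → ℝ} (hφ : PolyLip φ) :
    (fun ω => φ (Y ω)) ∈ S.H :=
  S.comp_mem d (fun i ω => Y ω i) hY φ (cllip_iff_polyLip.2 hφ)

theorem comp_real_mem {f : Ω → ℝ} (hf : f ∈ S.H) {φ : ℝ → ℝ} (hφ : PolyLip φ) :
    (fun ω => φ (f ω)) ∈ S.H := by
  have h := IsRandomVector.comp_mem (S := S) (d := 1)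
    (Y := fun ω => WithLp.toLp 2 fun _ => f ω) (fun _ => by simpa using hf)
    (hφ.comp (PolyLip.clm (EuclideanSpace.proj (0 : Fin 1) : EuclideanSpace ℝ (Fin 1) →L[ℝ] ℝ)))
  simpa using h

theorem const_mem (c : ℝ) : (fun _ => c) ∈ S.H :=
  comp_real_mem (f := 0) (φ := fun _ => c) S.H.zero_mem (PolyLip.const c)

theorem abs_mem {f : Ω → ℝ} (hf : f ∈ S.H) : (fun ω => |f ω|) ∈ S.H :=
  comp_real_mem hf PolyLip.norm

end Membership

/-! ### Real-valued calculus of the sub-linear expectation -/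

/-- `f` belongs to `H` and its absolute value has a finite expectation. -/
def L1 (f : Ω → ℝ) : Prop := f ∈ S.H ∧ S.exp (fun ω => |f ω|) < ⊤

/-- The sub-linear expectation as a real number. -/
noncomputable def rexp (f : Ω → ℝ) : ℝ := (S.exp f).toReal

variable {S}

theorem exp_mono {f g : Ω → ℝ} (hf : f ∈ S.H) (hg : g ∈ S.H) (h : ∀ ω, f ω ≤ g ω) :
    S.exp f ≤ S.exp g :=
  S.mono g hg f hf h

theorem exp_nonneg {f : Ω → ℝ} (hf : f ∈ S.H) (h : ∀ ω, 0 ≤ f ω) : 0 ≤ S.exp f := by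
  have := exp_mono (const_mem 0) hf h
  rwa [S.const] at this

/-- Otherwise sub-additivity would give `f + |f| ≥ 0` the expectation `⊥`, since `𝔼|f|` is finite.
-/
theorem exp_ne_bot {f : Ω → ℝ} (hf : S.L1 f) : S.exp f ≠ ⊥ := by
  intro hbot
  have hm := abs_mem hf.1
  have h0 := exp_nonneg hm fun ω => abs_nonneg _
  have h := S.subadd f hf.1 _ hm (fun h => by simp [hbot] at h) (fun h => hf.2.ne h.2)
  rw [hbot, EReal.bot_add] at h
  have h1 := exp_nonneg (S.H.add_mem hf.1 hm) fun ω => by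
    have := neg_abs_le (f ω); simp only [Pi.add_apply]; linarith
  simpa using h1.trans h

theorem exp_ne_top {f : Ω → ℝ} (hf : S.L1 f) : S.exp f ≠ ⊤ :=
  ((exp_mono hf.1 (abs_mem hf.1) fun _ => le_abs_self _).trans_lt hf.2).ne

theorem coe_rexp {f : Ω → ℝ} (hf : S.L1 f) : (S.rexp f : EReal) = S.exp f :=
  EReal.coe_toReal (exp_ne_top hf) (exp_ne_bot hf)

namespace L1

theorem of_abs_le {f g : Ω → ℝ} (hg : S.L1 g) (hf : f ∈ S.H) (h : ∀ ω, |f ω| ≤ g ω) :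
    S.L1 f :=
  ⟨hf, (exp_mono (abs_mem hf) (abs_mem hg.1) fun ω => (h ω).trans (le_abs_self _)).trans_lt hg.2⟩

theorem of_nonneg {f : Ω → ℝ} (hf : f ∈ S.H) (h0 : ∀ ω, 0 ≤ f ω) (h : S.exp f < ⊤) :
    S.L1 f :=
  ⟨hf, by simpa only [abs_of_nonneg (h0 _)] using h⟩

theorem const (c : ℝ) : S.L1 (fun _ => c) :=
  ⟨const_mem c, by rw [S.const]; exact EReal.coe_lt_top _⟩

theorem abs {f : Ω → ℝ} (hf : S.L1 f) : S.L1 (fun ω => |f ω|) :=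
  ⟨abs_mem hf.1, by simpa using hf.2⟩

theorem add {f g : Ω → ℝ} (hf : S.L1 f) (hg : S.L1 g) : S.L1 (fun ω => f ω + g ω) := by
  refine of_abs_le (g := (fun ω => |f ω|) + fun ω => |g ω|) ?_ (S.H.add_mem hf.1 hg.1)
    fun ω => abs_add_le _ _
  refine of_nonneg (S.H.add_mem (abs_mem hf.1) (abs_mem hg.1))
    (fun ω => add_nonneg (abs_nonneg _) (abs_nonneg _)) ?_
  refine (S.subadd _ (abs_mem hf.1) _ (abs_mem hg.1) (fun h => hf.2.ne h.1)
    (fun h => hg.2.ne h.2)).trans_lt (EReal.add_lt_top hf.2.ne hg.2.ne)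

theorem smul {f : Ω → ℝ} (hf : S.L1 f) (a : ℝ) : S.L1 (fun ω => a * f ω) := by
  have hm := S.H.smul_mem |a| (abs_mem hf.1)
  refine of_abs_le (g := |a| • fun ω => |f ω|) (of_nonneg hm
    (fun ω => mul_nonneg (abs_nonneg _) (abs_nonneg _)) ?_) (S.H.smul_mem a hf.1)
    fun ω => (abs_mul _ _).le
  rw [S.homog _ (abs_mem hf.1) _ (abs_nonneg a), ← coe_rexp hf.abs, ← EReal.coe_mul]
  exact EReal.coe_lt_top _

end L1

theorem rexp_mono {f g : Ω → ℝ} (hf : S.L1 f) (hg : S.L1 g) (h : ∀ ω, f ω ≤ g ω) :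
    S.rexp f ≤ S.rexp g := by
  rw [← EReal.coe_le_coe_iff, coe_rexp hf, coe_rexp hg]
  exact exp_mono hf.1 hg.1 h

variable (S) in
theorem rexp_const (c : ℝ) : S.rexp (fun _ => c) = c := by
  simp [rexp, S.const]

theorem rexp_add_le {f g : Ω → ℝ} (hf : S.L1 f) (hg : S.L1 g) :
    S.rexp (fun ω => f ω + g ω) ≤ S.rexp f + S.rexp g := by
  rw [← EReal.coe_le_coe_iff, EReal.coe_add, coe_rexp hf, coe_rexp hg, coe_rexp (hf.add hg)]
  exact S.subadd f hf.1 g hg.1 (fun h => exp_ne_top hf h.1) (fun h => exp_ne_bot hf h.1)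

theorem rexp_mul {f : Ω → ℝ} (hf : S.L1 f) {a : ℝ} (ha : 0 ≤ a) :
    S.rexp (fun ω => a * f ω) = a * S.rexp f := by
  rw [← EReal.coe_eq_coe_iff, EReal.coe_mul, coe_rexp hf, coe_rexp (hf.smul a)]
  exact S.homog f hf.1 a ha

theorem rexp_le_add_of_le {f g h : Ω → ℝ} (hf : S.L1 f) (hg : S.L1 g) (hh : S.L1 h)
    (hle : ∀ ω, f ω ≤ g ω + h ω) : S.rexp f ≤ S.rexp g + S.rexp h :=
  (rexp_mono hf (hg.add hh) hle).trans (rexp_add_le hg hh)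

theorem rexp_le_add_const {f g : Ω → ℝ} (hf : S.L1 f) (hg : S.L1 g) (c : ℝ)
    (hle : ∀ ω, f ω ≤ g ω + c) : S.rexp f ≤ S.rexp g + c := by
  simpa only [rexp_const] using rexp_le_add_of_le hf hg (L1.const c) hle

theorem abs_rexp_sub_le {f g h : Ω → ℝ} (hf : S.L1 f) (hg : S.L1 g) (hh : S.L1 h)
    (hle : ∀ ω, |f ω - g ω| ≤ h ω) : |S.rexp f - S.rexp g| ≤ S.rexp h := by
  have h1 := rexp_le_add_of_le hf hg hh fun ω => by linarith [(abs_le.1 (hle ω)).2]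
  have h2 := rexp_le_add_of_le hg hf hh fun ω => by linarith [(abs_le.1 (hle ω)).1]
  exact abs_le.2 ⟨by linarith, by linarith⟩

theorem rexp_nonneg {f : Ω → ℝ} (hf : S.L1 f) (h : ∀ ω, 0 ≤ f ω) : 0 ≤ S.rexp f := by
  simpa only [rexp_const] using rexp_mono (L1.const 0) hf h

/-! ### Truncation of square integrable variables -/

section SquareIntegrable

variable {f : Ω → ℝ}

theorem sq_mem (hf : f ∈ S.H) : (fun ω => f ω ^ 2) ∈ S.H := by
  simpa using comp_real_mem hf PolyLip.id.norm_sq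

theorem L1.of_sq (hf : f ∈ S.H) (h2 : S.L1 (fun ω => f ω ^ 2)) : S.L1 f :=
  ((L1.const 1).add h2).of_abs_le hf fun ω => by
    rw [← sq_abs]; nlinarith [sq_nonneg (|f ω| - 1), abs_nonneg (f ω)]

theorem truncation_mem (hf : f ∈ S.H) (c : ℝ) : (fun ω => max (-c) (min (f ω) c)) ∈ S.H := by
  refine comp_real_mem (φ := fun t => max (-c) (min t c)) hf
    (PolyLip.of_lipschitz 1 zero_le_one fun x y => ?_)
  simp only [Real.norm_eq_abs, one_mul]
  exact (abs_max_sub_max_le_max _ _ _ _).trans (max_le (by simp)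
    ((abs_min_sub_min_le_max _ _ _ _).trans (by simp)))

theorem abs_truncation_sub_le {t c : ℝ} (hc : 0 < c) :
    |max (-c) (min t c) - t| ≤ c⁻¹ * t ^ 2 := by
  have h0 : 0 ≤ c⁻¹ * t ^ 2 := by positivity
  have hk : c ≤ |t| → |t| ≤ c⁻¹ * t ^ 2 := fun h => by
    rw [inv_mul_eq_div, le_div_iff₀ hc, ← sq_abs]; nlinarith [abs_nonneg t]
  rcases le_total t c with h1 | h1
  · rw [min_eq_left h1]
    rcases le_total (-c) t with h2 | h2
    · rw [max_eq_right h2]; simpa using h0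
    · rw [max_eq_left h2, abs_of_nonneg (by linarith)]
      have := abs_of_nonpos (show t ≤ 0 by linarith)
      have := hk (by linarith)
      linarith
  · rw [min_eq_right h1, max_eq_right (by linarith), abs_of_nonpos (by linarith)]
    have := abs_of_nonneg (show 0 ≤ t by linarith)
    have := hk (by linarith)
    linarith

/-- Truncating at level `c` changes `f` by at most `f² / c`, hence its expectation by at most `𝔼[f²]
/ c`. -/
theorem truncExp_eq_of_sq (hf : f ∈ S.H) (h2 : S.L1 (fun ω => f ω ^ 2)) :
    S.truncExp f = S.rexp f := by
  have h1 := L1.of_sq hf h2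
  have hb : ∀ c : ℝ, 0 < c → S.L1 (fun ω => max (-c) (min (f ω) c)) := fun c hc =>
    (L1.const c).of_abs_le (truncation_mem hf c) fun ω =>
      abs_le.2 ⟨le_max_left _ _, max_le (by linarith) (min_le_right _ _)⟩
  have hr : Tendsto (fun c : ℝ => S.rexp fun ω => max (-c) (min (f ω) c)) atTop
      (𝓝 (S.rexp f)) := by
    rw [tendsto_iff_norm_sub_tendsto_zero]
    have hz : Tendsto (fun c : ℝ => c⁻¹ * S.rexp fun ω => f ω ^ 2) atTop (𝓝 0) := by
      simpa using tendsto_inv_atTop_zero.mul_const (S.rexp fun ω => f ω ^ 2)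
    refine squeeze_zero' (Eventually.of_forall fun c => norm_nonneg _) ?_ hz
    filter_upwards [eventually_gt_atTop 0] with c hc
    rw [← rexp_mul h2 (inv_nonneg.2 hc.le)]
    exact abs_rexp_sub_le (hb c hc) h1 (h2.smul _) fun ω => abs_truncation_sub_le hc
  have he : Tendsto (fun c : ℝ => S.exp fun ω => max (-c) (min (f ω) c)) atTop
      (𝓝 (S.rexp f : EReal)) := by
    refine ((continuous_coe_real_ereal.tendsto _).comp hr).congr' ?_
    filter_upwards [eventually_gt_atTop 0] with c hc using coe_rexp (hb c hc)
  exact he.limUnder_eq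

/-- The excess over `c` is at most `f² / c`, uniformly in the upper truncation level. -/
theorem mem_H1_of_sq (hf : f ∈ S.H) (h2 : S.L1 (fun ω => f ω ^ 2)) : f ∈ S.H1 := by
  refine ⟨hf, ?_⟩
  have hm : ∀ c d : ℝ, (fun ω => max (min |f ω| d - c) 0) ∈ S.H := fun c d => by
    refine comp_real_mem (φ := fun t => max (min |t| d - c) 0) hf
      (PolyLip.of_lipschitz 1 zero_le_one fun x y => ?_)
    simp only [Real.norm_eq_abs, one_mul]
    refine (abs_max_sub_max_le_max _ _ _ _).trans (max_le ?_ (by simp))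
    rw [sub_sub_sub_cancel_right]
    exact (abs_min_sub_min_le_max _ _ _ _).trans (max_le (abs_abs_sub_abs_le _ _) (by simp))
  have hz : Tendsto (fun p : ℝ × ℝ => ((p.1⁻¹ * S.rexp fun ω => f ω ^ 2 : ℝ) : EReal))
      (atTop ×ˢ atTop) (𝓝 0) := by
    have : Tendsto (fun c : ℝ => c⁻¹ * S.rexp fun ω => f ω ^ 2) atTop (𝓝 0) := by
      simpa using tendsto_inv_atTop_zero.mul_const (S.rexp fun ω => f ω ^ 2)
    exact (continuous_coe_real_ereal.tendsto 0).comp (this.comp tendsto_fst)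
  refine tendsto_of_tendsto_of_tendsto_of_le_of_le' tendsto_const_nhds hz
    (Eventually.of_forall fun p => exp_nonneg (hm _ _) fun ω => le_max_right _ _) ?_
  filter_upwards [tendsto_fst.eventually (eventually_gt_atTop (0 : ℝ))] with p hp
  rw [← rexp_mul h2 (inv_nonneg.2 hp.le), coe_rexp (h2.smul _)]
  refine exp_mono (hm _ _) (h2.smul _).1 fun ω => max_le ?_ (by positivity)
  have h1 : |f ω| - p.1 ≤ p.1⁻¹ * f ω ^ 2 := by
    rw [inv_mul_eq_div, le_div_iff₀ hp, ← sq_abs]; nlinarith [sq_nonneg (|f ω| - p.1)]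
  linarith [min_le_left |f ω| p.2]

end SquareIntegrable

/-! ### Means under dominated linear expectations -/

section RandomVector

variable {d : ℕ} {Y : Ω → EuclideanSpace ℝ (Fin d)}

theorem IsRandomVector.norm_sq_mem_L1 (hY : S.IsRandomVector Y)
    (h2 : S.exp (fun ω => ‖Y ω‖ ^ 2) < ⊤) : S.L1 (fun ω => ‖Y ω‖ ^ 2) :=
  L1.of_nonneg (hY.comp_mem PolyLip.id.norm_sq) (fun _ => by positivity) h2

theorem IsRandomVector.inner_mem (hY : S.IsRandomVector Y) (v : EuclideanSpace ℝ (Fin d)) :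
    (fun ω => inner ℝ v (Y ω)) ∈ S.H :=
  hY.comp_mem ((PolyLip.const v).inner PolyLip.id)

theorem sq_mem_L1_of_abs_le_norm (h2 : S.L1 (fun ω => ‖Y ω‖ ^ 2)) {f : Ω → ℝ} (hf : f ∈ S.H)
    (K : ℝ) (h : ∀ ω, |f ω| ≤ K * ‖Y ω‖) : S.L1 (fun ω => f ω ^ 2) :=
  (h2.smul (K ^ 2)).of_abs_le (sq_mem hf) fun ω => by
    rw [abs_of_nonneg (sq_nonneg _), ← mul_pow, ← sq_abs]
    exact pow_le_pow_left₀ (abs_nonneg _) (h ω) 2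

theorem inner_le_rexp_of_mem_meanSet (hY : S.IsRandomVector Y)
    (h2 : S.L1 (fun ω => ‖Y ω‖ ^ 2)) {μ : EuclideanSpace ℝ (Fin d)} (hμ : μ ∈ S.meanSet Y)
    (v : EuclideanSpace ℝ (Fin d)) : inner ℝ v μ ≤ S.rexp fun ω => inner ℝ v (Y ω) := by
  obtain ⟨L, hL, rfl⟩ := hμ
  have hsq := fun u => sq_mem_L1_of_abs_le_norm h2 (hY.inner_mem u) ‖u‖
    fun ω => abs_real_inner_le_norm u (Y ω)
  have hcoord : ∀ i, (fun ω => Y ω i) ∈ S.H1 := fun i =>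
    mem_H1_of_sq (hY i) (sq_mem_L1_of_abs_le_norm h2 (hY i) 1 fun ω => by
      simpa using PiLp.norm_apply_le (Y ω) i)
  have hin : ∀ u : EuclideanSpace ℝ (Fin d),
      (fun ω => inner ℝ u (Y ω)) = ∑ i, u i • fun ω => Y ω i := fun u => by
    ext ω
    simp [PiLp.inner_apply, mul_comm]
  have key : ∀ s : Finset (Fin d), ((∑ i ∈ s, v i • fun ω => Y ω i) ∈ S.H1) ∧
      L (∑ i ∈ s, v i • fun ω => Y ω i) = ∑ i ∈ s, v i * L fun ω => Y ω i := by
    intro s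
    -- Additivity of `L` is available only on `H1`, so each partial sum must be placed there; it is
    -- the inner product of `Y` with `v` restricted to `s`.
    have hmem : ∀ s : Finset (Fin d), (∑ i ∈ s, v i • fun ω => Y ω i) ∈ S.H1 := fun s => by
      have := hin (WithLp.toLp 2 fun i => if i ∈ s then v i else 0)
      simp only [ite_smul, zero_smul, Finset.sum_ite_mem, Finset.univ_inter] at this
      rw [← this]
      exact mem_H1_of_sq (hY.inner_mem _) (hsq _)
    refine ⟨hmem s, ?_⟩
    induction s using Finset.induction_on with
    | empty => exact (hL.const 0).trans Finset.sum_empty.symm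
    | insert a s ha ih =>
      rw [Finset.sum_insert ha, Finset.sum_insert ha,
        hL.add _ (by simpa using hmem {a}) _ (hmem s), hL.smul _ (hcoord a), ih]
  have h := hL.le _ (key Finset.univ).1
  rw [(key Finset.univ).2, ← hin, truncExp_eq_of_sq (hY.inner_mem v) (hsq v),
    EReal.coe_le_coe_iff] at h
  refine le_trans (le_of_eq ?_) h
  simp [PiLp.inner_apply, mul_comm]

/-- Combine the mean inequality in the direction `2μ` with `2⟨μ, Y⟩ ≤ |Y|² + |μ|²`. -/
theorem norm_sq_le_rexp_of_mem_meanSet (hY : S.IsRandomVector Y)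
    (h2 : S.L1 (fun ω => ‖Y ω‖ ^ 2)) {μ : EuclideanSpace ℝ (Fin d)} (hμ : μ ∈ S.meanSet Y) :
    ‖μ‖ ^ 2 ≤ S.rexp fun ω => ‖Y ω‖ ^ 2 := by
  have h := inner_le_rexp_of_mem_meanSet hY h2 hμ ((2 : ℝ) • μ)
  have h1 : S.L1 (fun ω => inner ℝ ((2 : ℝ) • μ) (Y ω)) := L1.of_sq (hY.inner_mem _)
    (sq_mem_L1_of_abs_le_norm h2 (hY.inner_mem _) _ fun ω => abs_real_inner_le_norm _ (Y ω))
  have h3 := rexp_le_add_const h1 h2 (‖μ‖ ^ 2) fun ω => by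
    rw [real_inner_smul_left, real_inner_comm]
    linarith [norm_sub_sq_real (Y ω) μ, sq_nonneg ‖Y ω - μ‖]
  rw [real_inner_smul_left, real_inner_self_eq_norm_sq] at h
  linarith

end RandomVector

/-! ### One step of the recursion under independence -/

section OneStep

variable {d : ℕ} {E : Type*} [NormedAddCommGroup E] {Y : Ω → EuclideanSpace ℝ (Fin d)}
  {μ : EuclideanSpace ℝ (Fin d)}

/-- The expectation of a quadratic polynomial in `Y` whose leading coefficient is not positive is
bounded below by means of `E|Y|²` and of any mean of `Y`. -/
theorem le_rexp_quadratic (hY : S.IsRandomVector Y) (h2 : S.L1 fun ω => ‖Y ω‖ ^ 2)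
    (hμ : μ ∈ S.meanSet Y) (p : ℝ) {a : ℝ} (ha : 0 ≤ a) (b : EuclideanSpace ℝ (Fin d))
    (hint : S.L1 fun ω => p - (2 * inner ℝ b (Y ω - μ) + a * ‖Y ω - μ‖ ^ 2)) :
    p - a * (S.rexp (fun ω => ‖Y ω‖ ^ 2) - ‖μ‖ ^ 2) ≤
      S.rexp fun ω => p - (2 * inner ℝ b (Y ω - μ) + a * ‖Y ω - μ‖ ^ 2) := by
  -- Adding `a|Y|²` to the polynomial cancels its quadratic term and leaves, up to a constant, the
  -- linear form `⟨v, Y⟩`.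
  set v := (2 * a) • μ - (2 : ℝ) • b with hv
  have hi : S.L1 fun ω => inner ℝ v (Y ω) := L1.of_sq (hY.inner_mem v)
    (sq_mem_L1_of_abs_le_norm h2 (hY.inner_mem v) ‖v‖ fun ω => abs_real_inner_le_norm _ _)
  have h1 := inner_le_rexp_of_mem_meanSet hY h2 hμ v
  have h3 := rexp_le_add_const hi (hint.add (h2.smul a))
    (-(p + 2 * inner ℝ b μ - a * ‖μ‖ ^ 2)) fun ω => by
    rw [norm_sub_sq_real, hv, inner_sub_left, inner_sub_right, real_inner_smul_left,
      real_inner_smul_left, real_inner_comm μ (Y ω)]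
    apply le_of_eq
    ring
  have h4 := rexp_add_le hint (h2.smul a)
  rw [rexp_mul h2 ha] at h4
  have h5 : inner ℝ v μ = 2 * a * ‖μ‖ ^ 2 - 2 * inner ℝ b μ := by
    rw [hv, inner_sub_left, real_inner_smul_left, real_inner_smul_left,
      real_inner_self_eq_norm_sq]
  linarith

/-- Freezing `X` reduces the bound to `le_rexp_quadratic`; since `a ≤ 1` and `|μ|² ≤ 𝔼|Y|²`, the
coefficient `a` can be replaced by `1`. The work lies in the side conditions of `IndepTo`:
integrability, and membership in `H` of the two inner expectations as functions of `X`. -/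
theorem le_rexp_of_indepTo {X : Ω → E}
    (hXY : ∀ ψ : E × EuclideanSpace ℝ (Fin d) → ℝ, PolyLip ψ → (fun ω => ψ (X ω, Y ω)) ∈ S.H)
    (hY : S.IsRandomVector Y) (h2 : S.L1 fun ω => ‖Y ω‖ ^ 2) (hμ : μ ∈ S.meanSet Y)
    (hind : S.IndepTo Y X) {p a : E → ℝ} {b : E → EuclideanSpace ℝ (Fin d)} (hp : PolyLip p)
    (ha : PolyLip a) (hb : PolyLip b) (ha0 : ∀ x, 0 ≤ a x) (ha1 : ∀ x, a x ≤ 1) {B : ℝ}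
    (hbB : ∀ x, ‖b x‖ ≤ B) (hpX : S.L1 fun ω => p (X ω)) :
    (S.L1 fun ω =>
      p (X ω) - (2 * inner ℝ (b (X ω)) (Y ω - μ) + a (X ω) * ‖Y ω - μ‖ ^ 2)) ∧
    S.rexp (fun ω => p (X ω)) - (S.rexp (fun ω => ‖Y ω‖ ^ 2) - ‖μ‖ ^ 2) ≤
      S.rexp fun ω =>
        p (X ω) - (2 * inner ℝ (b (X ω)) (Y ω - μ) + a (X ω) * ‖Y ω - μ‖ ^ 2) := by
  set φ : E × EuclideanSpace ℝ (Fin d) → ℝ := fun q =>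
    p q.1 - (2 * inner ℝ (b q.1) (q.2 - μ) + a q.1 * ‖q.2 - μ‖ ^ 2) with hφdef
  have hY' : PolyLip fun q : E × EuclideanSpace ℝ (Fin d) => q.2 - μ :=
    PolyLip.snd.sub (PolyLip.const μ)
  have hφ : PolyLip φ := (hp.comp PolyLip.fst).sub
    (((PolyLip.const 2).mul ((hb.comp PolyLip.fst).inner hY')).add
      ((ha.comp PolyLip.fst).mul hY'.norm_sq))
  -- an integrable bound for the increments of `φ` in the first variable
  set R : Ω → ℝ := fun ω => 1 + ‖Y ω - μ‖ ^ 2 with hR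
  have hRint : S.L1 R := by
    refine ((L1.const (1 + 2 * ‖μ‖ ^ 2)).add (h2.smul 2)).of_abs_le
      (hY.comp_mem ((PolyLip.const 1).add (PolyLip.id.sub (PolyLip.const μ)).norm_sq))
      fun ω => ?_
    rw [abs_of_nonneg (by positivity)]
    have := norm_sub_le (Y ω) μ
    nlinarith [norm_nonneg (Y ω - μ), sq_nonneg (‖Y ω‖ - ‖μ‖), norm_nonneg μ, norm_nonneg (Y ω)]
  have hquad : ∀ (u : EuclideanSpace ℝ (Fin d)) (c : ℝ) (ω : Ω),
      |2 * inner ℝ u (Y ω - μ) + c * ‖Y ω - μ‖ ^ 2| ≤ (‖u‖ + |c|) * R ω := fun u c ω => by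
    have h1 := abs_real_inner_le_norm u (Y ω - μ)
    have h3 := abs_add_le (2 * inner ℝ u (Y ω - μ)) (c * ‖Y ω - μ‖ ^ 2)
    rw [abs_mul, abs_mul, abs_two, abs_of_nonneg (sq_nonneg ‖Y ω - μ‖)] at h3
    have h4 : ‖u‖ * (2 * ‖Y ω - μ‖) ≤ ‖u‖ * R ω :=
      mul_le_mul_of_nonneg_left (by nlinarith [sq_nonneg (‖Y ω - μ‖ - 1)]) (norm_nonneg u)
    have h5 : |c| * ‖Y ω - μ‖ ^ 2 ≤ |c| * R ω :=
      mul_le_mul_of_nonneg_left (by linarith) (abs_nonneg c)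
    linarith
  have hinc : ∀ x y ω, |φ (x, Y ω) - φ (y, Y ω)| ≤
      (|p x - p y| + (‖b x - b y‖ + |a x - a y|)) * R ω := fun x y ω => by
    have h1 := hquad (b x - b y) (a x - a y) ω
    have h3 : φ (x, Y ω) - φ (y, Y ω) = (p x - p y) -
        (2 * inner ℝ (b x - b y) (Y ω - μ) + (a x - a y) * ‖Y ω - μ‖ ^ 2) := by
      simp only [hφdef, inner_sub_left]; ring
    have h4 := abs_sub (p x - p y)
      (2 * inner ℝ (b x - b y) (Y ω - μ) + (a x - a y) * ‖Y ω - μ‖ ^ 2)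
    have h5 : |p x - p y| * 1 ≤ |p x - p y| * R ω :=
      mul_le_mul_of_nonneg_left (by simp [hR]) (abs_nonneg _)
    rw [h3]
    linarith
  have hbd : ∀ x ω, |φ (x, Y ω)| ≤ |p x| + (B + 1) * R ω := fun x ω => by
    have h1 := hquad (b x) (a x) ω
    have h3 := abs_sub (p x) (2 * inner ℝ (b x) (Y ω - μ) + a x * ‖Y ω - μ‖ ^ 2)
    have h4 : (‖b x‖ + |a x|) * R ω ≤ (B + 1) * R ω := by
      rw [abs_of_nonneg (ha0 x)]
      exact mul_le_mul_of_nonneg_right (add_le_add (hbB x) (ha1 x)) (by simp only [hR]; positivity)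
    exact h3.trans (by linarith)
  have hint : ∀ x, S.L1 fun ω => φ (x, Y ω) := fun x =>
    ((L1.const |p x|).add (hRint.smul (B + 1))).of_abs_le
      (hY.comp_mem (hφ.comp ((PolyLip.const x).prodMk PolyLip.id))) (hbd x)
  -- One argument serves both inner expectations, with `T` the absolute value and the identity: by
  -- `hinc` they are Lipschitz functions of `(p, b, a)`.
  have hcond : ∀ T : ℝ → ℝ, (∀ s t, |T s - T t| ≤ |s - t|) →
      (∀ x, S.L1 fun ω => T (φ (x, Y ω))) → PolyLip fun x => S.rexp fun ω => T (φ (x, Y ω)) := by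
    intro T hT hTint
    refine (hp.prodMk (hb.prodMk ha)).of_norm_sub_le (3 * S.rexp R)
      (mul_nonneg (by norm_num) (rexp_nonneg hRint fun ω => by simp only [hR]; positivity))
      fun x y => ?_
    have h1 := abs_rexp_sub_le (hTint x) (hTint y) (hRint.smul _)
      fun ω => (hT _ _).trans (hinc x y ω)
    rw [rexp_mul hRint (by positivity)] at h1
    refine h1.trans ?_
    rw [mul_right_comm]
    refine mul_le_mul_of_nonneg_right ?_
      (rexp_nonneg hRint fun ω => by simp only [hR]; positivity)
    have e1 := norm_fst_le ((p x, b x, a x) - (p y, b y, a y))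
    have e2 := norm_snd_le ((p x, b x, a x) - (p y, b y, a y))
    have e3 := norm_fst_le ((p x, b x, a x) - (p y, b y, a y)).2
    have e4 := norm_snd_le ((p x, b x, a x) - (p y, b y, a y)).2
    simp only [Prod.mk_sub_mk, Real.norm_eq_abs] at e1 e2 e3 e4 ⊢
    linarith
  have habs := hcond (fun t => |t|) (fun s t => abs_abs_sub_abs_le s t) fun x => (hint x).abs
  have hid := hcond (fun t => t) (fun s t => le_rfl) hint
  have hX : ∀ ψ : E → ℝ, PolyLip ψ → (fun ω => ψ (X ω)) ∈ S.H := fun ψ hψ =>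
    hXY _ (hψ.comp PolyLip.fst)
  -- Boundedness of `a` and `b` separates the variables in the dominating function, so integrability
  -- needs no independence.
  have hφX : S.L1 fun ω => φ (X ω, Y ω) :=
    (hpX.abs.add (hRint.smul (B + 1))).of_abs_le (hXY _ hφ) fun ω => hbd (X ω) ω
  have hrabs : S.L1 fun ω' => S.rexp fun ω => |φ (X ω', Y ω)| := by
    refine (hpX.abs.add (L1.const (S.rexp fun ω => (B + 1) * R ω))).of_abs_le (hX _ habs)
      fun ω' => ?_
    rw [abs_of_nonneg (rexp_nonneg (hint _).abs fun ω => abs_nonneg _), add_comm]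
    exact rexp_le_add_const (hint _).abs (hRint.smul (B + 1)) _ fun ω =>
      (hbd (X ω') ω).trans_eq (add_comm _ _)
  have hrid : S.L1 fun ω' => S.rexp fun ω => φ (X ω', Y ω) :=
    hrabs.of_abs_le (hX _ hid) fun ω' => abs_le.2
      ⟨by
        have h := rexp_le_add_of_le (L1.const 0) (hint (X ω')) (hint (X ω')).abs fun ω => by
          linarith [neg_abs_le (φ (X ω', Y ω))]
        rw [rexp_const] at h
        linarith,
      rexp_mono (hint _) (hint _).abs fun ω => le_abs_self _⟩
  have heq : (S.rexp fun ω => φ (X ω, Y ω)) = S.rexp fun ω' => S.rexp fun ω => φ (X ω', Y ω) :=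
    congrArg EReal.toReal (hind φ (cllip_iff_polyLip.2 hφ) (fun x => (hint x).2) (hX _ habs)
      hrabs.2 (hX _ hid))
  refine ⟨hφX, ?_⟩
  have hfin := rexp_le_add_const hpX hrid (S.rexp (fun ω => ‖Y ω‖ ^ 2) - ‖μ‖ ^ 2) fun ω' => by
    have h1 := le_rexp_quadratic hY h2 hμ (p (X ω')) (ha0 _) (b (X ω')) (hint (X ω'))
    have h3 := norm_sq_le_rexp_of_mem_meanSet hY h2 hμ
    have h4 := mul_le_of_le_one_left (sub_nonneg.2 h3) (ha1 (X ω'))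
    linarith
  rw [← heq] at hfin
  linarith

end OneStep

end Space

/-! ### Pathwise inequality for the smoothed stopped sums -/

section Pathwise

variable {V : Type*} [NormedAddCommGroup V] {x : ℝ}

/-- A Lipschitz cutoff function, equal to `1` on `(-∞, 3x/4]` and to `0` on `[x, ∞)`. -/
noncomputable def cutoff (x t : ℝ) : ℝ := max 0 (min 1 (4 * (1 - t / x)))

theorem cutoff_nonneg (x t : ℝ) : 0 ≤ cutoff x t := le_max_left _ _

theorem cutoff_le_one (x t : ℝ) : cutoff x t ≤ 1 := max_le zero_le_one (min_le_left _ _)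

theorem cutoff_eq_zero (hx : 0 < x) {t : ℝ} (ht : x ≤ t) : cutoff x t = 0 := by
  have : 1 ≤ t / x := (one_le_div hx).2 ht
  exact max_eq_left ((min_le_right _ _).trans (by linarith))

theorem cutoff_eq_one (hx : 0 < x) {t : ℝ} (ht : t ≤ 3 / 4 * x) : cutoff x t = 1 := by
  have : t / x ≤ 3 / 4 := (div_le_iff₀ hx).2 ht
  rw [cutoff, min_eq_left (by linarith), max_eq_right zero_le_one]

theorem polyLip_cutoff (x : ℝ) : PolyLip (cutoff x) :=
  PolyLip.of_lipschitz (4 * |x⁻¹|) (by positivity) fun s t => by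
    have h1 := abs_max_sub_max_le_max 0 (min 1 (4 * (1 - s / x))) 0 (min 1 (4 * (1 - t / x)))
    have h2 := abs_min_sub_min_le_max 1 (4 * (1 - s / x)) 1 (4 * (1 - t / x))
    have h3 : 4 * (1 - s / x) - 4 * (1 - t / x) = -(4 * x⁻¹ * (s - t)) := by
      simp only [div_eq_mul_inv]; ring
    rw [h3, abs_neg, abs_mul, abs_mul, abs_of_pos (four_pos : (0 : ℝ) < 4)] at h2
    simp only [sub_self, abs_zero] at h1 h2
    exact h1.trans (max_le (by positivity) (h2.trans (max_le (by positivity) le_rfl)))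

/-- Partial sums of the centred sequence. -/
def centredSum (μ z : ℕ → V) (k : ℕ) : V := ∑ i ∈ Finset.range k, (z i - μ i)

theorem centredSum_congr {μ z w : ℕ → V} {k : ℕ} (h : ∀ i < k, z i = w i) :
    centredSum μ z k = centredSum μ w k :=
  Finset.sum_congr rfl fun i hi => by rw [h i (Finset.mem_range.1 hi)]

theorem polyLip_centredSum {E : Type*} [NormedAddCommGroup E] {f : E → ℕ → V}
    (hf : ∀ i, PolyLip fun e => f e i) (μ : ℕ → V) (k : ℕ) :
    PolyLip fun e => centredSum μ (f e) k :=
  PolyLip.finset_sum _ fun i _ => (hf i).sub (PolyLip.const _)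

/-- A Lipschitz version of the indicator of `max_{m ≤ k} |S_m| < x`. -/
noncomputable def smoothIndicator (x : ℝ) (μ z : ℕ → V) (k : ℕ) : ℝ :=
  ∏ i ∈ Finset.range k, cutoff x ‖centredSum μ z (i + 1)‖

theorem smoothIndicator_nonneg (x : ℝ) (μ z : ℕ → V) (k : ℕ) : 0 ≤ smoothIndicator x μ z k :=
  Finset.prod_nonneg fun _ _ => cutoff_nonneg _ _

theorem smoothIndicator_le_one (x : ℝ) (μ z : ℕ → V) (k : ℕ) : smoothIndicator x μ z k ≤ 1 :=
  Finset.prod_le_one (fun _ _ => cutoff_nonneg _ _) fun _ _ => cutoff_le_one _ _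

theorem smoothIndicator_eq_zero (hx : 0 < x) {μ z : ℕ → V} {k m : ℕ} (hm : m < k)
    (h : x ≤ ‖centredSum μ z (m + 1)‖) : smoothIndicator x μ z k = 0 :=
  Finset.prod_eq_zero (Finset.mem_range.2 hm) (cutoff_eq_zero hx h)

/-- The last factor of the product vanishes once `|S_k| ≥ x`. This supplies the bound on `b` in
`le_rexp_of_indepTo`. -/
theorem norm_smoothIndicator_smul_le [NormedSpace ℝ V] (hx : 0 < x) (μ z : ℕ → V) (k : ℕ) :
    ‖smoothIndicator x μ z k • centredSum μ z k‖ ≤ x := by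
  rw [norm_smul, Real.norm_of_nonneg (smoothIndicator_nonneg _ _ _ _)]
  rcases le_total x ‖centredSum μ z k‖ with h | h
  · cases k with
    | zero => simpa [centredSum] using hx.le
    | succ k => rw [smoothIndicator_eq_zero hx k.lt_succ_self h, zero_mul]; exact hx.le
  · exact (mul_le_of_le_one_left (norm_nonneg _) (smoothIndicator_le_one _ _ _ _)).trans h

theorem smoothIndicator_congr {μ z w : ℕ → V} {k : ℕ} (h : ∀ i < k, z i = w i) :
    smoothIndicator x μ z k = smoothIndicator x μ w k :=
  Finset.prod_congr rfl fun i hi => by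
    rw [centredSum_congr fun j hj => h j (by have := Finset.mem_range.1 hi; omega)]

theorem polyLip_smoothIndicator {E : Type*} [NormedAddCommGroup E] {f : E → ℕ → V}
    (hf : ∀ i, PolyLip fun e => f e i) (x : ℝ) (μ : ℕ → V) (k : ℕ) :
    PolyLip fun e => smoothIndicator x μ (f e) k := by
  induction k with
  | zero => simpa [smoothIndicator] using PolyLip.const (1 : ℝ)
  | succ k ih =>
    simp only [smoothIndicator, Finset.prod_range_succ] at ih ⊢
    exact ih.mul ((polyLip_cutoff x).comp (PolyLip.norm.comp (polyLip_centredSum hf μ (k + 1))))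

variable [InnerProductSpace ℝ V]

/-- The sum of the weighted increments of `|S_k|²`. -/
noncomputable def weightedSquares (x : ℝ) (μ z : ℕ → V) (k : ℕ) : ℝ :=
  ∑ i ∈ Finset.range k, (2 * inner ℝ (smoothIndicator x μ z i • centredSum μ z i) (z i - μ i) +
    smoothIndicator x μ z i * ‖z i - μ i‖ ^ 2)

/-- By induction: passing from `k` to `k + 1` costs nothing as long as `g_k (1 - χ)(|S_{k+1}|² -
x²/2) ≥ 0`, where `χ` is the new cutoff factor. Where `χ ≠ 1`, `|S_{k+1}|` exceeds `3x/4`, and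
`(3/4)² = 9/16 ≥ 1/2`; this is the source of the factor `2` in the theorem. -/
theorem le_weightedSquares (hx : 0 < x) (μ z : ℕ → V) (k : ℕ) :
    x ^ 2 / 2 * (1 - smoothIndicator x μ z k) +
      smoothIndicator x μ z k * ‖centredSum μ z k‖ ^ 2 ≤ weightedSquares x μ z k := by
  induction k with
  | zero => simp [smoothIndicator, centredSum, weightedSquares]
  | succ k ih =>
    have hS : centredSum μ z (k + 1) = centredSum μ z k + (z k - μ k) :=
      Finset.sum_range_succ _ _
    have hg : smoothIndicator x μ z (k + 1) =
      smoothIndicator x μ z k * cutoff x ‖centredSum μ z (k + 1)‖ := Finset.prod_range_succ _ _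
    have hW : weightedSquares x μ z (k + 1) = weightedSquares x μ z k +
        smoothIndicator x μ z k * (‖centredSum μ z (k + 1)‖ ^ 2 - ‖centredSum μ z k‖ ^ 2) := by
      rw [weightedSquares, Finset.sum_range_succ, ← weightedSquares, hS, norm_add_sq_real,
        real_inner_smul_left]
      ring
    have hg0 := smoothIndicator_nonneg x μ z k
    have key : 0 ≤ smoothIndicator x μ z k * ((1 - cutoff x ‖centredSum μ z (k + 1)‖) *
        (‖centredSum μ z (k + 1)‖ ^ 2 - x ^ 2 / 2)) := by
      refine mul_nonneg hg0 ?_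
      rcases le_total ‖centredSum μ z (k + 1)‖ (3 / 4 * x) with h | h
      · rw [cutoff_eq_one hx h]; simp
      · exact mul_nonneg (sub_nonneg.2 (cutoff_le_one _ _)) (by nlinarith)
    rw [hW, hg]
    linarith

theorem weightedSquares_congr {μ z w : ℕ → V} {k : ℕ} (h : ∀ i < k, z i = w i) :
    weightedSquares x μ z k = weightedSquares x μ w k :=
  Finset.sum_congr rfl fun i hi => by
    have hi := Finset.mem_range.1 hi
    rw [centredSum_congr fun j hj => h j (hj.trans hi),
      smoothIndicator_congr fun j hj => h j (hj.trans hi), h i hi]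

theorem polyLip_weightedSquares {E : Type*} [NormedAddCommGroup E] {f : E → ℕ → V}
    (hf : ∀ i, PolyLip fun e => f e i) (x : ℝ) (μ : ℕ → V) (k : ℕ) :
    PolyLip fun e => weightedSquares x μ (f e) k :=
  PolyLip.finset_sum _ fun i _ =>
    ((PolyLip.const 2).mul (((polyLip_smoothIndicator hf x μ i).smul
      (polyLip_centredSum hf μ i)).inner ((hf i).sub (PolyLip.const _)))).add
      ((polyLip_smoothIndicator hf x μ i).mul ((hf i).sub (PolyLip.const _)).norm_sq)

end Pathwise

/-! ### Recursion along the sequence and the maximal inequality -/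

/-- Extension of a finite sequence by zero. -/
def extendZero {V : Type*} [Zero V] {k : ℕ} (y : Fin k → V) (i : ℕ) : V :=
  if h : i < k then y ⟨i, h⟩ else 0

theorem polyLip_extendZero {V : Type*} [NormedAddCommGroup V] {k : ℕ} (i : ℕ) :
    PolyLip fun y : Fin k → V => extendZero y i := by
  by_cases h : i < k
  · simp only [extendZero, dif_pos h]
    exact PolyLip.of_lipschitz 1 zero_le_one fun y w => by
      simpa using norm_le_pi_norm (y - w) ⟨i, h⟩
  · simpa only [extendZero, dif_neg h] using PolyLip.const (0 : V)

namespace Space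

variable {Ω : Type*} {S : Space Ω} {d : ℕ}

/-- Each step applies `le_rexp_of_indepTo` with `p = -W_k`, `a = g_k`, `b = g_k S_k`, viewed as
functions of the finite past; `extendZero` is harmless because these depend only on the indices
below `k`. -/
theorem le_rexp_neg_weightedSquares {N : ℕ} {Z : ℕ → Ω → EuclideanSpace ℝ (Fin d)}
    (hZ : ∀ k, S.IsRandomVector (Z k)) (h2 : ∀ k, S.L1 fun ω => ‖Z k ω‖ ^ 2)
    (hind : ∀ k < N, S.IndepTo (Z k) fun ω (i : Fin k) => Z i ω)
    {μ : ℕ → EuclideanSpace ℝ (Fin d)} (hμ : ∀ k < N, μ k ∈ S.meanSet (Z k)) {x : ℝ}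
    (hx : 0 < x) {k : ℕ} (hk : k ≤ N) :
    (S.L1 fun ω => -weightedSquares x μ (fun i => Z i ω) k) ∧
      -∑ i ∈ Finset.range k, (S.rexp (fun ω => ‖Z i ω‖ ^ 2) - ‖μ i‖ ^ 2) ≤
        S.rexp fun ω => -weightedSquares x μ (fun i => Z i ω) k := by
  induction k with
  | zero => simpa [weightedSquares, rexp_const] using L1.const (S := S) 0
  | succ k ih =>
    obtain ⟨ih1, ih2⟩ := ih (by omega)
    set X : Ω → Fin k → EuclideanSpace ℝ (Fin d) := fun ω i => Z i ω with hXdef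
    have hX : ∀ ω, ∀ i < k, extendZero (X ω) i = Z i ω := fun ω i hi => by
      simp [extendZero, hi, hXdef]
    have hXY : ∀ ψ : (Fin k → EuclideanSpace ℝ (Fin d)) × EuclideanSpace ℝ (Fin d) → ℝ,
        PolyLip ψ → (fun ω => ψ (X ω, Z k ω)) ∈ S.H := fun ψ hψ => by
      have hT : PolyLip fun y : Fin (k + 1) → EuclideanSpace ℝ (Fin d) =>
          ((fun i : Fin k => y i.castSucc), y (Fin.last k)) :=
        PolyLip.of_lipschitz 1 zero_le_one fun y w => by
          rw [one_mul, Prod.norm_def]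
          exact max_le ((pi_norm_le_iff_of_nonneg (norm_nonneg _)).2 fun i =>
            norm_le_pi_norm (y - w) i.castSucc) (norm_le_pi_norm (y - w) (Fin.last k))
      exact comp_polyLip_mem (X := fun i : Fin (k + 1) => Z i) (fun i => hZ i) (hψ.comp hT)
    have hW : ∀ ω, weightedSquares x μ (extendZero (X ω)) k =
        weightedSquares x μ (fun i => Z i ω) k := fun ω => weightedSquares_congr (hX ω)
    have hg : ∀ ω, smoothIndicator x μ (extendZero (X ω)) k =
        smoothIndicator x μ (fun i => Z i ω) k := fun ω => smoothIndicator_congr (hX ω)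
    have hS : ∀ ω, centredSum μ (extendZero (X ω)) k = centredSum μ (fun i => Z i ω) k :=
      fun ω => centredSum_congr (hX ω)
    have step := le_rexp_of_indepTo (X := X) hXY (hZ k) (h2 k) (hμ k hk) (hind k hk)
      (p := fun y => -weightedSquares x μ (extendZero y) k)
      (a := fun y => smoothIndicator x μ (extendZero y) k)
      (b := fun y => smoothIndicator x μ (extendZero y) k • centredSum μ (extendZero y) k)
      (polyLip_weightedSquares polyLip_extendZero x μ k).neg
      (polyLip_smoothIndicator polyLip_extendZero x μ k)
      ((polyLip_smoothIndicator polyLip_extendZero x μ k).smul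
        (polyLip_centredSum polyLip_extendZero μ k))
      (fun _ => smoothIndicator_nonneg _ _ _ _) (fun _ => smoothIndicator_le_one _ _ _ _)
      (fun _ => norm_smoothIndicator_smul_le hx _ _ _) (by simpa only [hW] using ih1)
    simp only [hW, hg, hS] at step
    have hsucc : ∀ ω, -weightedSquares x μ (fun i => Z i ω) (k + 1) =
        -weightedSquares x μ (fun i => Z i ω) k -
        (2 * inner ℝ (smoothIndicator x μ (fun i => Z i ω) k • centredSum μ (fun i => Z i ω) k)
          (Z k ω - μ k) + smoothIndicator x μ (fun i => Z i ω) k * ‖Z k ω - μ k‖ ^ 2) :=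
      fun ω => by rw [weightedSquares, Finset.sum_range_succ, ← weightedSquares]; ring
    simp only [hsucc]
    refine ⟨step.1, ?_⟩
    rw [Finset.sum_range_succ]
    linarith [step.2]

/-- Kolmogorov's maximal inequality for the lower capacity. -/
theorem lowerCap_le_of_indepSeq {N : ℕ} {Z : Fin N → Ω → EuclideanSpace ℝ (Fin d)}
    (hZ : ∀ k, S.IsRandomVector (Z k)) (hindep : S.IndepSeq Z)
    (hmom : ∀ k, S.exp (fun ω => ‖Z k ω‖ ^ 2) < ⊤) {μ : Fin N → EuclideanSpace ℝ (Fin d)}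
    (hμ : ∀ k, μ k ∈ S.meanSet (Z k)) {x : ℝ} (hx : 0 < x) :
    S.lowerCap {ω | x ≤ ⨆ m : Fin N, ‖∑ k ∈ Finset.Iic m, (Z k ω - μ k)‖} ≤
      ((2 / x ^ 2 * ∑ k, ((S.exp (fun ω => ‖Z k ω‖ ^ 2)).toReal - ‖μ k‖ ^ 2) : ℝ) : EReal) := by
  set Z' : ℕ → Ω → EuclideanSpace ℝ (Fin d) := fun i ω => extendZero (fun k => Z k ω) i with hZ'
  have hZk : ∀ k : Fin N, Z' k = Z k := fun k => by
    ext1 ω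
    simp [hZ', extendZero]
  have hZ0 : ∀ k, N ≤ k → Z' k = fun _ => 0 := fun k hk => by
    ext1 ω
    simp [hZ', extendZero, hk.not_gt]
  have hrv : ∀ k, S.IsRandomVector (Z' k) := fun k => by
    rcases lt_or_ge k N with hk | hk
    · exact hZk ⟨k, hk⟩ ▸ hZ _
    · rw [hZ0 k hk]
      exact fun i => const_mem 0
  have hsq : ∀ k, S.L1 fun ω => ‖Z' k ω‖ ^ 2 := fun k => by
    rcases lt_or_ge k N with hk | hk
    · exact (hrv k).norm_sq_mem_L1 (by rw [hZk ⟨k, hk⟩]; exact hmom _)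
    · rw [hZ0 k hk]
      simpa using L1.const (S := S) 0
  have hind : ∀ k < N, S.IndepTo (Z' k) fun ω (i : Fin k) => Z' i ω := fun k hk => by
    have h := hindep ⟨k, hk⟩
    rw [← hZk] at h
    convert h using 4 with ω i
    exact (hZk ⟨i, i.isLt.trans hk⟩).symm ▸ rfl
  obtain ⟨hint, hle⟩ := le_rexp_neg_weightedSquares hrv hsq hind (μ := extendZero μ)
    (fun k hk => by rw [hZk ⟨k, hk⟩]; simpa [extendZero, hk] using hμ ⟨k, hk⟩) hx le_rfl
  set σ := ∑ k, ((S.exp (fun ω => ‖Z k ω‖ ^ 2)).toReal - ‖μ k‖ ^ 2) with hσ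
  have hsum : ∑ i ∈ Finset.range N, (S.rexp (fun ω => ‖Z' i ω‖ ^ 2) - ‖extendZero μ i‖ ^ 2) = σ := by
    rw [Finset.sum_range, hσ]
    refine Finset.sum_congr rfl fun k _ => ?_
    rw [hZk]
    simp [extendZero, rexp]
  rw [hsum] at hle
  have hx2 : 0 < 2 / x ^ 2 := by positivity
  have hlow : ((1 - 2 / x ^ 2 * σ : ℝ) : EReal) ≤
      S.upperCap {ω | x ≤ ⨆ m : Fin N, ‖∑ k ∈ Finset.Iic m, (Z k ω - μ k)‖}ᶜ := by
    refine le_iInf₂ fun ξ hξ => ?_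
    have hint' := (L1.const 1).add (hint.smul (2 / x ^ 2))
    have h1 : 1 - 2 / x ^ 2 * σ ≤ S.rexp fun ω =>
        1 + 2 / x ^ 2 * -weightedSquares x (extendZero μ) (fun i => Z' i ω) N := by
      -- Sub-additivity with the constant `-1` gives the needed direction of translation: `𝔼[cf] + 1
      -- ≤ 𝔼[1 + cf]`.
      have h3 := rexp_le_add_const (hint.smul (2 / x ^ 2)) hint' (-1) fun ω => by linarith
      rw [rexp_mul hint hx2.le] at h3
      nlinarith
    refine (EReal.coe_le_coe_iff.2 h1).trans ?_
    rw [coe_rexp hint']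
    refine exp_mono hint'.1 hξ.1 fun ω => le_trans ?_ (hξ.2 ω)
    have h4 : 1 + 2 / x ^ 2 * -weightedSquares x (extendZero μ) (fun i => Z' i ω) N ≤
        smoothIndicator x (extendZero μ) (fun i => Z' i ω) N := by
      have h5 := le_weightedSquares hx (extendZero μ) (fun i => Z' i ω) N
      have h6 := smoothIndicator_nonneg x (extendZero μ) (fun i => Z' i ω) N
      have h7 : x ^ 2 / 2 * (1 - smoothIndicator x (extendZero μ) (fun i => Z' i ω) N) ≤
          weightedSquares x (extendZero μ) (fun i => Z' i ω) N :=
        (le_add_of_nonneg_right (by positivity)).trans h5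
      have h8 := mul_le_mul_of_nonneg_left h7 hx2.le
      rw [← mul_assoc, div_mul_div_cancel₀' two_ne_zero, div_self (by positivity), one_mul] at h8
      linarith
    refine h4.trans ?_
    by_cases hω : x ≤ ⨆ m : Fin N, ‖∑ k ∈ Finset.Iic m, (Z k ω - μ k)‖
    -- For `N = 0` the real supremum takes the default value `0 < x`, so this case cannot occur.
    · have hne : Nonempty (Fin N) := by
        by_contra hem
        rw [not_nonempty_iff] at hem
        rw [Real.iSup_of_isEmpty] at hω
        linarith
      obtain ⟨m, hm⟩ := exists_eq_ciSup_of_finite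
        (f := fun m : Fin N => ‖∑ k ∈ Finset.Iic m, (Z k ω - μ k)‖)
      rw [← hm] at hω
      -- Indices start at `0`, so the sum up to and including `m` has `m + 1` terms.
      have hS : centredSum (extendZero μ) (fun i => Z' i ω) (m + 1) =
          ∑ k ∈ Finset.Iic m, (Z k ω - μ k) := by
        rw [centredSum]
        symm
        refine Finset.sum_bij (fun k _ => (k : ℕ)) (fun k hk => ?_) (fun _ _ _ _ h => Fin.ext h)
          (fun i hi => ?_) (fun k _ => ?_)
        · have := Fin.le_def.1 (Finset.mem_Iic.1 hk)
          exact Finset.mem_range.2 (by omega)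
        · have := Finset.mem_range.1 hi
          exact ⟨⟨i, by omega⟩, Finset.mem_Iic.2 (Fin.le_def.2 (by simp; omega)), rfl⟩
        · rw [hZk]
          simp [extendZero]
      rw [smoothIndicator_eq_zero hx m.isLt (by rw [hS]; exact hω)]
      exact Set.indicator_nonneg (fun _ _ => zero_le_one) ω
    · rw [Set.indicator_of_mem (by exact hω)]
      exact smoothIndicator_le_one _ _ _ _
  refine (EReal.sub_le_sub le_rfl hlow).trans_eq ?_
  rw [← EReal.coe_one, ← EReal.coe_sub]
  congr 1
  ring

end Space

end SubLinear

theorem mainTheorem11 {Ω : Type*} (S : SubLinear.Space Ω) (d : ℕ) (N : ℕ → ℕ)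
    (Z : (n : ℕ) → Fin (N n) → Ω → EuclideanSpace ℝ (Fin d))
    (hZ : ∀ n k, S.IsRandomVector (Z n k))
    (hindep : ∀ n, S.IndepSeq (Z n))
    (hmom : ∀ n k, S.exp (fun ω => ‖Z n k ω‖ ^ 2) < ⊤)
    (μ : (n : ℕ) → Fin (N n) → EuclideanSpace ℝ (Fin d))
    (hμ : ∀ n k, μ n k ∈ S.meanSet (Z n k))
    (n : ℕ) (x : ℝ) (hx : 0 < x) :
    S.lowerCap {ω | x ≤ ⨆ m : Fin (N n), ‖∑ k ∈ Finset.Iic m, (Z n k ω - μ n k)‖} ≤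
      ((2 / x ^ 2 * ∑ k, ((S.exp (fun ω => ‖Z n k ω‖ ^ 2)).toReal - ‖μ n k‖ ^ 2) : ℝ) : EReal) :=
  SubLinear.Space.lowerCap_le_of_indepSeq (hZ n) (hindep n) (hmom n) (hμ n) hx
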